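/- All graphs are finite and simple. A vertex $v$ of a connected graph $G$ is a cut vertex if $G-v$ is disconnected. A block of $G$ is a maximal connected subgraph of $G$ that has no cut vertex of its own. A clique tree is a connected graph each of whose blocks is a complete graph. The color-change rule says: if $u$ is a blue vertex and exactly one neighbor $v$ of $u$ is white, then the color of $v$ may be changed to blue. A set $S$ of vertices is a zero forcing set if, when the vertices in $S$ are initially blue and all others white, applications of the color-change rule make all vertices blue. The zero forcing number $Z(G)$ is the smallest size of a zero forcing set of $G$. Let $G$ be a clique tree on $n$ vertices with blocks $B_1,\dots,B_b$, each having at least $3$ vertices, and for a vertex $v$ let $bi_G(v)$ be the number of blocks containing $v$. Then $$Z(G)=\sum_{i=1}^b Z(B_i)-\sum_{v\in V(G)}\bigl(bi_G(v)-1\bigr).$$ Consequently, with $k=Z(G)$, one has $k=n-b$ and $$\left\lfloor \frac n2\right\rfloor+1\le k\le n-1.$$ Moreover, if $k=\lfloor n/2\rfloor+1$ and $n$ is even, then $G$ has exactly $\lfloor n/2\rfloor-2$ blocks $K_3$, exactly one block $K_4$, and no other block; if $k=\lfloor n/2\rfloor+1$ and $n$ is odd, then every block of $G$ is a $K_3$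 and there are exactly $\lfloor n/2\rfloor$ of them. -/

import Mathlib

namespace CliqueTree

/-- `v` is a cut vertex of the connected graph `G` if `G - v` is disconnected
(the graph without vertices does not count as disconnected). -/
def IsCutVertex {V : Type*} (G : SimpleGraph V) (v : V) : Prop :=
  G.Connected ∧ ¬ (G.induce {v}ᶜ).Preconnected

/-- A block of `G` is a maximal connected subgraph of `G` that has no cut vertex (of its own). -/
def IsBlock {V : Type*} (G : SimpleGraph V) (H : G.Subgraph) : Prop :=
  Maximal (fun K : G.Subgraph => K.Connected ∧ ∀ v : K.verts, ¬ IsCutVertex K.coe v) H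

/-- A clique tree is a connected graph each of whose blocks is a complete graph. -/
def IsCliqueTree {V : Type*} (G : SimpleGraph V) : Prop :=
  G.Connected ∧ ∀ H : G.Subgraph, IsBlock G H → H.coe = ⊤

/-- The finite set of all blocks of a finite graph. -/
noncomputable def blocks {V : Type*} [Finite V] (G : SimpleGraph V) : Finset G.Subgraph :=
  (Set.toFinite {H : G.Subgraph | IsBlock G H}).toFinset

/-- The block index of `v`: the number of blocks that contain `v`. -/
noncomputable def blockIndex {V : Type*} (G : SimpleGraph V) (v : V) : ℕ :=
  {H : G.Subgraph | IsBlock G H ∧ v ∈ H.verts}.ncard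

/-- One application of the color-change rule, where `B` is the set of blue vertices: some blue
vertex `u` has exactly one white neighbor `v`, and the new set of blue vertices is `B ∪ {v}`. -/
def ColorChange {V : Type*} (G : SimpleGraph V) (B B' : Set V) : Prop :=
  ∃ u ∈ B, ∃ v, (∀ w, (G.Adj u w ∧ w ∉ B) ↔ w = v) ∧ B' = insert v B

/-- `S` is a zero forcing set if, starting with `S` blue and all other vertices white,
applications of the color-change rule can turn all vertices blue. -/
def IsZeroForcingSet {V : Type*} (G : SimpleGraph V) (S : Set V) : Prop :=
  Relation.ReflTransGen (ColorChange G) S Set.univ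

/-- The zero forcing number of a finite graph: the smallest size of a zero forcing set.
(The set of sizes is nonempty, as the set of all vertices is a zero forcing set.) -/
noncomputable def zeroForcingNumber {V : Type*} (G : SimpleGraph V) : ℕ :=
  sInf {k : ℕ | ∃ S : Finset V, S.card = k ∧ IsZeroForcingSet G (S : Set V)}

end CliqueTree

/-! The heart is `k = n - b`. Lower bound: blocks are cliques, so when `u` forces `v`, all other
vertices of a block containing both are already blue, and the force completes that block; hence
there are at most `b` forces. Upper bound: split at cut vertices. `ForcesWithout` carries a root
that never forces; when two pieces share only `v`, a forcing set of the second rooted at `v` can be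
glued to one of the first, dropping `v` from the second. A clique on at least 3 vertices may leave
one non-root vertex white, forced by another non-root vertex. The same induction gives `∑ (|B| - 1)
= n - 1`. With `Z(B) = |B| - 1` and the double count `∑ bi(v) = ∑ |B|`, the formula follows. In
terms of the excess `e = ∑ (|B| - 3)` one has `n = 2b + 1 + e`, which gives the bounds; the extremal
cases are `e = 1` and `e = 0`. -/

namespace CliqueTree

open Finset

/-! ### Blocks and separations -/

section Basic

variable {V : Type*} {G : SimpleGraph V}

/-- A set that induces a connected graph without cut vertex is contained in a block. -/
theorem exists_isBlock_superset [Finite V] {W : Set V} (hW : (G.induce W).Connected)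
    (hcut : ∀ v ∈ W, (G.induce (W \ {v})).Preconnected) :
    ∃ H : G.Subgraph, IsBlock G H ∧ W ⊆ H.verts := by
  let K : G.Subgraph := (⊤ : G.Subgraph).induce W
  have hK : K.Connected ∧ ∀ v : K.verts, ¬ IsCutVertex K.coe v := by
    have hadj : ∀ a b : K.verts, K.coe.Adj a b ↔ G.Adj a b := by
      rintro ⟨a, ha⟩ ⟨b, hb⟩
      change a ∈ W at ha
      change b ∈ W at hb
      simp [K, ha, hb]
    refine ⟨?_, ?_⟩
    · rw [SimpleGraph.Subgraph.connected_iff']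
      refine hW.map (⟨fun x => ⟨x.1, x.2⟩, ?_⟩ : G.induce W →g K.coe) ?_
      · intro a b hab
        exact (hadj _ _).2 hab
      · rintro ⟨a, ha⟩
        exact ⟨⟨a, ha⟩, rfl⟩
    · rintro ⟨v, hv⟩ ⟨-, h⟩
      apply h
      refine (hcut v hv).map (⟨fun x => ⟨⟨x.1, x.2.1⟩, ?_⟩, ?_⟩ :
        G.induce (W \ {v}) →g K.coe.induce {⟨v, hv⟩}ᶜ) ?_
      · intro hx
        exact x.2.2 (congrArg Subtype.val hx)
      · intro a b hab
        exact (hadj _ _).2 hab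
      · rintro ⟨⟨a, ha⟩, hav⟩
        refine ⟨⟨a, ha, fun h => hav ?_⟩, rfl⟩
        exact Subtype.ext h
  obtain ⟨H, hKH, hH⟩ := (Set.toFinite {K : G.Subgraph | K.Connected ∧
    ∀ v : K.verts, ¬ IsCutVertex K.coe v}).exists_le_maximal hK
  exact ⟨H, hH, hKH.1⟩

theorem exists_isBlock_mem [Finite V] (x : V) : ∃ H : G.Subgraph, IsBlock G H ∧ x ∈ H.verts := by
  obtain ⟨H, hH, hx⟩ := exists_isBlock_superset (G := G) (W := {x})
    (by
      have : Nonempty ({x} : Set V) := ⟨⟨x, rfl⟩⟩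
      exact ⟨SimpleGraph.Preconnected.of_subsingleton⟩)
    (by
      rintro v rfl
      have : Subsingleton (({v} : Set V) \ {v} : Set V) := by
        rw [Set.subsingleton_coe]; simp
      exact SimpleGraph.Preconnected.of_subsingleton)
  exact ⟨H, hH, hx rfl⟩

theorem exists_isBlock_of_adj [Finite V] {u v : V} (h : G.Adj u v) :
    ∃ H : G.Subgraph, IsBlock G H ∧ u ∈ H.verts ∧ v ∈ H.verts := by
  obtain ⟨H, hH, hx⟩ := exists_isBlock_superset (G := G) (W := {u, v})
    (SimpleGraph.induce_pair_connected_of_adj h)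
    (by
      intro w hw
      have : Subsingleton (({u, v} : Set V) \ {w} : Set V) := by
        rw [Set.subsingleton_coe]
        rintro a ⟨ha, ha'⟩ b ⟨hb, hb'⟩
        simp only [Set.mem_insert_iff, Set.mem_singleton_iff] at *
        grind
      exact SimpleGraph.Preconnected.of_subsingleton)
  exact ⟨H, hH, hx (by simp), hx (by simp)⟩

theorem IsCliqueTree.adj_of_mem (hG : IsCliqueTree G) {H : G.Subgraph} (hH : IsBlock G H)
    {x y : V} (hx : x ∈ H.verts) (hy : y ∈ H.verts) (hxy : x ≠ y) : G.Adj x y := by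
  have h : H.coe.Adj ⟨x, hx⟩ ⟨y, hy⟩ := by
    rw [hG.2 H hH]
    simpa using hxy
  exact H.adj_sub h

theorem IsCliqueTree.eq_of_verts_eq (hG : IsCliqueTree G) {H K : G.Subgraph} (hH : IsBlock G H)
    (hK : IsBlock G K) (h : H.verts = K.verts) : H = K := by
  have key : ∀ {L : G.Subgraph}, IsBlock G L → ∀ a b,
      L.Adj a b ↔ a ∈ L.verts ∧ b ∈ L.verts ∧ a ≠ b := by
    intro L hL a b
    refine ⟨fun hab => ⟨L.edge_vert hab, L.edge_vert hab.symm, hab.ne⟩, ?_⟩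
    rintro ⟨ha, hb, hab⟩
    have : L.coe.Adj ⟨a, ha⟩ ⟨b, hb⟩ := by
      rw [hG.2 L hL]
      simpa using hab
    exact this
  refine SimpleGraph.Subgraph.ext h ?_
  funext a b
  rw [key hH, key hK, h]

@[simp]
theorem mem_blocks [Finite V] {H : G.Subgraph} : H ∈ blocks G ↔ IsBlock G H := by
  simp [blocks]

/-- If the only way to leave `A` inside `W` is through `v`, then `A ∪ {v}` is connected. -/
theorem connected_induce_insert {W A : Set V} {v : V} (hW : (G.induce W).Connected) (hv : v ∈ W)
    (hAW : A ⊆ W) (hA : ∀ a ∈ A, ∀ b ∈ W, G.Adj a b → b ∈ A ∨ b = v) :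
    (G.induce (insert v A)).Connected := by
  -- A walk towards `v` stays in `A` until it first meets `v`, and its remainder is not needed.
  have key : ∀ x y : W, (G.induce W).Walk x y → y.1 = v → ∀ hx : x.1 ∈ insert v A,
      (G.induce (insert v A)).Reachable ⟨x, hx⟩ ⟨v, Set.mem_insert _ _⟩ := by
    intro x y p
    induction p with
    | nil =>
      intro h hx
      have : (⟨_, hx⟩ : (insert v A : Set V)) = ⟨v, Set.mem_insert _ _⟩ := Subtype.ext h
      rw [this]
    | @cons x z y hxz p ih =>
      intro hy hx
      rcases Set.mem_insert_iff.1 hx with hxv | hxA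
      · have : (⟨x.1, hx⟩ : (insert v A : Set V)) = ⟨v, Set.mem_insert _ _⟩ := Subtype.ext hxv
        rw [this]
      · have hz : z.1 ∈ insert v A := by
          rcases hA x hxA z z.2 hxz with h | h
          · exact Or.inr h
          · exact Or.inl h
        have h1 : (G.induce (insert v A)).Adj ⟨x, hx⟩ ⟨z, hz⟩ := hxz
        exact h1.reachable.trans (ih hy hz)
  have hr : ∀ x : (insert v A : Set V),
      (G.induce (insert v A)).Reachable x ⟨v, Set.mem_insert _ _⟩ := by
    intro x
    have hxW : x.1 ∈ W := Set.insert_subset hv hAW x.2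
    obtain ⟨p⟩ := hW.preconnected ⟨x.1, hxW⟩ ⟨v, hv⟩
    exact key _ _ p rfl x.2
  have : Nonempty (insert v A : Set V) := ⟨⟨v, Set.mem_insert _ _⟩⟩
  exact ⟨fun x y => (hr x).trans (hr y).symm⟩

theorem exists_separation {U : Set V} (h : ¬ (G.induce U).Preconnected) :
    ∃ A ⊆ U, A.Nonempty ∧ (U \ A).Nonempty ∧ ∀ a ∈ A, ∀ b ∈ U \ A, ¬ G.Adj a b := by
  simp only [SimpleGraph.Preconnected, not_forall] at h
  obtain ⟨x, y, hxy⟩ := h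
  refine ⟨{z | ∃ hz : z ∈ U, (G.induce U).Reachable x ⟨z, hz⟩}, fun z hz => hz.1,
    ⟨x, x.2, .rfl⟩, ⟨y, y.2, fun hy => hxy hy.2⟩, ?_⟩
  rintro a ⟨ha, hxa⟩ b ⟨hb, hb'⟩ hab
  have h1 : (G.induce U).Adj ⟨a, ha⟩ ⟨b, hb⟩ := hab
  exact hb' ⟨hb, hxa.trans h1.reachable⟩

end Basic

/-! ### Rooted forcing and gluing -/

section Forcing

variable {V : Type*} {G : SimpleGraph V}

/-- No vertex of `W` other than `r` can force a vertex in the graph induced on `W`, when `T` is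
the set of blue vertices. -/
def IsStuck (G : SimpleGraph V) (W : Set V) (r : V) (T : Set V) : Prop :=
  ∀ u ∈ W, u ≠ r → u ∈ T → ∀ v, ¬ ∀ w, (w ∈ W ∧ G.Adj u w ∧ w ∉ T) ↔ w = v

/-- `S` forces all of `W`, in the graph induced on `W`, without using a force by `r ∈ S`. -/
def ForcesWithout (G : SimpleGraph V) (W : Set V) (r : V) (S : Set V) : Prop :=
  r ∈ S ∧ S ⊆ W ∧ ∀ T, S ⊆ T → IsStuck G W r T → W ⊆ T

/-- The first piece turns `v` blue without help from the second. Then the second fills up without a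
force by `v`, after which `v` has white neighbors in `W₁` only and may force there. -/
theorem ForcesWithout.glue {W W₁ W₂ S₁ S₂ : Set V} {r v : V} (hW : W = W₁ ∪ W₂)
    (hI : W₁ ∩ W₂ = {v}) (hr : r ∈ W₁)
    (hsep : ∀ a ∈ W₁, a ≠ v → ∀ b ∈ W₂, b ≠ v → ¬ G.Adj a b)
    (h₁ : ForcesWithout G W₁ r S₁) (h₂ : ForcesWithout G W₂ v S₂) :
    ForcesWithout G W r (S₁ ∪ S₂ \ {v}) := by
  subst hW
  have hv : v ∈ W₁ ∩ W₂ := hI ▸ rfl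
  have hI' : ∀ x ∈ W₁, x ∈ W₂ → x = v := fun x h h' => by
    have : x ∈ W₁ ∩ W₂ := ⟨h, h'⟩
    rwa [hI] at this
  obtain ⟨hr₁, hS₁, hf₁⟩ := h₁
  obtain ⟨hv₂, hS₂, hf₂⟩ := h₂
  refine ⟨Or.inl hr₁, Set.union_subset_union hS₁ (Set.sdiff_subset.trans hS₂), ?_⟩
  intro T hT hstuck
  have hT₁ : S₁ ⊆ T := Set.subset_union_left.trans hT
  have hvT : v ∈ T := by
    by_contra hvT
    refine hvT (hf₁ T hT₁ ?_ hv.1)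
    intro u hu hur huT z hz
    have huv : u ≠ v := fun h => hvT (h ▸ huT)
    refine hstuck u (Or.inl hu) hur huT z fun w => ?_
    rw [← hz w]
    refine ⟨fun ⟨hw, ha, hwT⟩ => ⟨?_, ha, hwT⟩, fun ⟨hw, ha, hwT⟩ => ⟨Or.inl hw, ha, hwT⟩⟩
    rcases hw with hw | hw
    · exact hw
    · by_cases hwv : w = v
      · exact hwv ▸ hv.1
      · exact absurd ha (hsep u hu huv w hw hwv)
  have hT₂ : W₂ ⊆ T := by
    refine hf₂ T ?_ ?_
    · intro x hx
      by_cases hxv : x = v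
      · exact hxv ▸ hvT
      · exact hT (Or.inr ⟨hx, hxv⟩)
    · intro u hu huv huT z hz
      -- If the root `r` lies in `W₂` it equals `v`, so no vertex of `W₂` other than `v` is barred
      -- from forcing.
      refine hstuck u (Or.inr hu) (fun h => huv (hI' u (h ▸ hr) hu)) huT z fun w => ?_
      rw [← hz w]
      refine ⟨fun ⟨hw, ha, hwT⟩ => ⟨?_, ha, hwT⟩, fun ⟨hw, ha, hwT⟩ => ⟨Or.inr hw, ha, hwT⟩⟩
      rcases hw with hw | hw
      · by_cases hwv : w = v
        · exact hwv ▸ hv.2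
        · exact absurd ha.symm (hsep w hw hwv u hu huv)
      · exact hw
  refine Set.union_subset (hf₁ T hT₁ ?_) hT₂
  intro u hu hur huT z hz
  refine hstuck u (Or.inl hu) hur huT z fun w => ?_
  rw [← hz w]
  refine ⟨fun ⟨hw, ha, hwT⟩ => ⟨?_, ha, hwT⟩, fun ⟨hw, ha, hwT⟩ => ⟨Or.inl hw, ha, hwT⟩⟩
  exact hw.resolve_right fun h => hwT (hT₂ h)

theorem forcesWithout_clique {W : Set V} {r u w : V} (hW : W.Pairwise G.Adj) (hr : r ∈ W)
    (hu : u ∈ W) (hw : w ∈ W) (hur : u ≠ r) (hwr : w ≠ r) (huw : u ≠ w) :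
    ForcesWithout G W r (W \ {w}) := by
  refine ⟨⟨hr, hwr.symm⟩, Set.sdiff_subset, fun T hT hstuck => ?_⟩
  have hwT : w ∈ T := by
    by_contra hwT
    refine hstuck u hu hur (hT ⟨hu, huw⟩) w fun x => ⟨?_, ?_⟩
    · rintro ⟨hx, -, hxT⟩
      by_contra hxw
      exact hxT (hT ⟨hx, hxw⟩)
    · rintro rfl
      exact ⟨hw, hW hu hw huw, hwT⟩
  intro x hx
  by_cases hxw : x = w
  · exact hxw ▸ hwT
  · exact hT ⟨hx, hxw⟩

/-- A maximal set reachable from `S` admits no further force, so it is stuck and hence everything.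
-/
theorem ForcesWithout.isZeroForcingSet [Finite V] {r : V} {S : Set V}
    (h : ForcesWithout G Set.univ r S) : IsZeroForcingSet G S := by
  obtain ⟨T, hST, hT⟩ := (Set.toFinite {T : Set V | Relation.ReflTransGen (ColorChange G) S T ∧
    S ⊆ T}).exists_le_maximal (a := S) ⟨.refl, le_rfl⟩
  have : Set.univ ⊆ T := by
    refine h.2.2 T hST ?_
    intro u _ _ huT v hv
    have hvT : v ∉ T := ((hv v).2 rfl).2.2
    have hstep : ColorChange G T (insert v T) := ⟨u, huT, v, fun w => by simpa using hv w, rfl⟩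
    exact hvT (hT.2 ⟨hT.1.1.tail hstep, hST.trans (Set.subset_insert _ _)⟩
      (Set.subset_insert _ _) (Set.mem_insert _ _))
  rw [Set.univ_subset_iff] at this
  subst this
  exact hT.1.1

theorem zeroForcingNumber_le {S : Finset V} (h : IsZeroForcingSet G (S : Set V)) :
    zeroForcingNumber G ≤ S.card :=
  Nat.sInf_le ⟨S, rfl, h⟩

theorem exists_card_eq_zeroForcingNumber [Fintype V] (G : SimpleGraph V) :
    ∃ S : Finset V, S.card = zeroForcingNumber G ∧ IsZeroForcingSet G (S : Set V) :=
  Nat.sInf_mem (s := {k : ℕ | ∃ S : Finset V, S.card = k ∧ IsZeroForcingSet G (S : Set V)})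
    ⟨_, Finset.univ, rfl, by rw [Finset.coe_univ]; exact .refl⟩

theorem zeroForcingNumber_top [Fintype V] (h : 2 ≤ Fintype.card V) :
    zeroForcingNumber (⊤ : SimpleGraph V) = Fintype.card V - 1 := by
  classical
  apply le_antisymm
  · obtain ⟨u, w, huw⟩ := Fintype.exists_pair_of_one_lt_card h
    have hS : IsZeroForcingSet (⊤ : SimpleGraph V) ((Finset.univ.erase w : Finset V) : Set V) := by
      refine .single ⟨u, by simpa using huw, w, fun x => ?_, ?_⟩
      · simp only [SimpleGraph.top_adj, coe_erase, coe_univ, Set.mem_sdiff, Set.mem_univ,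
          Set.mem_singleton_iff, true_and, not_not]
        exact ⟨fun h => h.2, fun h => ⟨h ▸ huw, h⟩⟩
      · ext x
        simp
    simpa using zeroForcingNumber_le hS
  · obtain ⟨S, hS, hf⟩ := exists_card_eq_zeroForcingNumber (⊤ : SimpleGraph V)
    rw [← hS]
    rcases Relation.ReflTransGen.cases_head hf with h | ⟨T, ⟨u, hu, v, hv, -⟩, -⟩
    · have : S = Finset.univ := by exact_mod_cast h
      simp [this]
    · have hsub : (Finset.univ : Finset V) ⊆ insert v S := by
        intro x _
        by_cases hx : x ∈ S
        · exact mem_insert_of_mem hx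
        · have : x = v := (hv x).1 ⟨fun h => hx (h ▸ hu), hx⟩
          simp [this]
      have h1 := card_le_card hsub
      have h2 := card_insert_le v S
      rw [card_univ] at h1
      omega

end Forcing

/-! ### Counting forces by blocks -/

section Main

variable {V : Type*} [Fintype V] {G : SimpleGraph V}

/-- In a clique tree every force completes a block, so there are at most as many forces as blocks. -/
theorem IsCliqueTree.card_le_card_add_card_blocks (hG : IsCliqueTree G) {S : Finset V}
    (hS : IsZeroForcingSet G (S : Set V)) : Fintype.card V ≤ S.card + (blocks G).card := by
  classical
  -- Potential: blue vertices plus blocks not yet entirely blue. A force adds one to the first and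
  -- lowers the second by at least one.
  have key : ∀ T : Set V, Relation.ReflTransGen (ColorChange G) T Set.univ →
      Fintype.card V ≤ T.ncard + ((blocks G).filter fun H => ¬ H.verts ⊆ T).card := by
    intro T hT
    induction hT using Relation.ReflTransGen.head_induction_on with
    | refl => simp [Set.ncard_univ]
    | @head T T' hstep _ ih =>
      obtain ⟨u, hu, v, hv, rfl⟩ := hstep
      obtain ⟨huv, hvT⟩ := (hv v).2 rfl
      obtain ⟨H, hH, huH, hvH⟩ := exists_isBlock_of_adj huv
      have hlt : ((blocks G).filter fun K => ¬ K.verts ⊆ insert v T).card <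
          ((blocks G).filter fun K => ¬ K.verts ⊆ T).card := by
        apply card_lt_card
        rw [Finset.ssubset_iff_of_subset]
        · refine ⟨H, by simpa [hH] using fun h => hvT (h hvH), ?_⟩
          simp only [mem_filter, mem_blocks, not_and, not_not]
          intro _ x hx
          by_cases hxu : x = u
          · exact Or.inr (hxu ▸ hu)
          by_contra hx'
          rw [Set.mem_insert_iff, not_or] at hx'
          exact hx'.1 ((hv x).1 ⟨hG.adj_of_mem hH huH hx (Ne.symm hxu), hx'.2⟩)
        · intro K hK
          simp only [mem_filter] at hK ⊢
          exact ⟨hK.1, fun h => hK.2 (h.trans (Set.subset_insert _ _))⟩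
      rw [Set.ncard_insert_of_notMem hvT] at ih
      omega
  have h := key S hS
  rw [Set.ncard_coe_finset] at h
  exact h.trans (Nat.add_le_add_left (card_filter_le _ _) _)

open Classical in
/-- The blocks of `G` that lie inside `W`. -/
noncomputable def blocksIn (G : SimpleGraph V) (W : Set V) : Finset G.Subgraph :=
  (blocks G).filter fun H => H.verts ⊆ W

/-- A connected set `W` that meets each block not inside `W` in at most one vertex satisfies the
block-size identity, and from every root it has a forcing set missing one vertex per block. -/
theorem IsCliqueTree.blocksIn_sum_and_forcesWithout (hG : IsCliqueTree G)
    (hsize : ∀ H : G.Subgraph, IsBlock G H → 3 ≤ H.verts.ncard) (n : ℕ) :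
    ∀ W : Set V, W.ncard = n → 2 ≤ W.ncard → (G.induce W).Connected →
      (∀ H, IsBlock G H → H.verts ⊆ W ∨ (H.verts ∩ W).Subsingleton) →
      ∑ H ∈ blocksIn G W, (H.verts.ncard - 1) + 1 = W.ncard ∧
      ∀ r ∈ W, ∃ S, ForcesWithout G W r S ∧ S.ncard + (blocksIn G W).card = W.ncard := by
  classical
  induction n using Nat.strong_induction_on with
  | _ n ih =>
  intro W hn hW2 hWc hWb
  by_cases hcut : ∀ v ∈ W, (G.induce (W \ {v})).Preconnected
  · obtain ⟨H, hH, hWH⟩ := exists_isBlock_superset hWc hcut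
    -- Otherwise `H` would meet `W` in at most one vertex, although it contains all of `W`.
    have hHW : H.verts ⊆ W := by
      rcases hWb H hH with h | h
      · exact h
      · rw [Set.inter_eq_right.2 hWH, ← Set.ncard_le_one_iff_subsingleton] at h
        omega
    have hEq : W = H.verts := hWH.antisymm hHW
    have hsing : blocksIn G W = {H} := by
      ext K
      simp only [blocksIn, mem_filter, mem_blocks, mem_singleton]
      refine ⟨fun ⟨hK, hKW⟩ => ?_, fun h => h ▸ ⟨hH, hHW⟩⟩
      have hKH : K ≤ H := ⟨hKW.trans hWH, fun a b hab => by
        have : H.coe.Adj ⟨a, hWH (hKW (K.edge_vert hab))⟩ ⟨b, hWH (hKW (K.edge_vert hab.symm))⟩ := by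
          rw [hG.2 H hH]
          simpa using hab.ne
        exact this⟩
      exact le_antisymm hKH (hK.2 hH.1 hKH)
    have h3 : 3 ≤ W.ncard := hEq ▸ hsize H hH
    refine ⟨?_, fun r hr => ?_⟩
    · rw [hsing, sum_singleton, ← hEq]
      omega
    -- Size at least 3 leaves two non-root vertices: one stays white, the other forces it.
    · have h1 : 1 < (W \ {r}).ncard := by
        rw [Set.ncard_sdiff_singleton_of_mem hr]
        omega
      obtain ⟨u, w, hu, hw, huw⟩ := (Set.one_lt_ncard_iff (Set.toFinite _)).1 h1
      refine ⟨W \ {w}, forcesWithout_clique ?_ hr hu.1 hw.1 hu.2 hw.2 huw, ?_⟩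
      · intro x hx y hy hxy
        exact hG.adj_of_mem hH (hWH hx) (hWH hy) hxy
      · rw [hsing, card_singleton, Set.ncard_sdiff_singleton_add_one hw.1]
  · simp only [not_forall] at hcut
    obtain ⟨v, hv, hdis⟩ := hcut
    -- The root is taken on the side of `A`, and the side of `B` is rooted at `v`; roots in `B`
    -- follow by exchanging the sides.
    have main : ∀ A B : Set V, A.Nonempty → B.Nonempty → W = insert v (A ∪ B) → v ∉ A → v ∉ B →
        Disjoint A B → (∀ a ∈ A, ∀ b ∈ B, ¬ G.Adj a b) →
        ∑ H ∈ blocksIn G W, (H.verts.ncard - 1) + 1 = W.ncard ∧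
        ∀ r ∈ insert v A, ∃ S, ForcesWithout G W r S ∧
          S.ncard + (blocksIn G W).card = W.ncard := by
      intro A B hAn hBn hWAB hvA hvB hAB hsep
      -- A block is a clique, so it cannot meet both `A` and `B`.
      have hcl : ∀ H, IsBlock G H → H.verts ⊆ W → H.verts ⊆ insert v A ∨ H.verts ⊆ insert v B := by
        intro H hH hHW
        by_contra! hcon
        obtain ⟨⟨x, hx, hxA⟩, y, hy, hyB⟩ := And.imp Set.not_subset.1 Set.not_subset.1 hcon
        have hxW := hHW hx
        have hyW := hHW hy
        rw [hWAB] at hxW hyW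
        simp only [Set.mem_insert_iff, Set.mem_union, not_or] at hxW hyW hxA hyB
        have hyA : y ∈ A := by tauto
        have hxB : x ∈ B := by tauto
        exact hsep y hyA x hxB (hG.adj_of_mem hH hy hx fun h => hxA.2 (h ▸ hyA))
      have hInt : insert v A ∩ insert v B = {v} := by
        rw [← Set.insert_inter_distrib, hAB.inter_eq]
        simp
      have sub : ∀ C D : Set V, C.Nonempty → D.Nonempty → W = insert v (C ∪ D) → v ∉ C → v ∉ D →
          Disjoint C D → insert v C ∩ insert v D = {v} →
          (∀ a ∈ C, ∀ b ∈ D, ¬ G.Adj a b) →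
          (∀ H, IsBlock G H → H.verts ⊆ W → H.verts ⊆ insert v C ∨ H.verts ⊆ insert v D) →
          ∑ H ∈ blocksIn G (insert v C), (H.verts.ncard - 1) + 1 = (insert v C).ncard ∧
          ∀ r ∈ insert v C, ∃ S, ForcesWithout G (insert v C) r S ∧
            S.ncard + (blocksIn G (insert v C)).card = (insert v C).ncard := by
        intro C D hCn hDn hWCD hvC hvD hCD hCDv hsep hcl
        have hCW : C ⊆ W := hWCD ▸ fun x hx => Or.inr (Or.inl hx)
        have hvCW : insert v C ⊆ W := Set.insert_subset hv hCW
        have hlt : (insert v C).ncard < W.ncard := by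
          apply Set.ncard_lt_ncard _ (Set.toFinite _)
          refine ⟨hvCW, fun h => ?_⟩
          obtain ⟨d, hd⟩ := hDn
          rcases h (hWCD ▸ Or.inr (Or.inr hd) : d ∈ W) with h | h
          · exact hvD (h ▸ hd)
          · exact hCD.notMem_of_mem_left h hd
        have h2 : 2 ≤ (insert v C).ncard := by
          rw [Set.ncard_insert_of_notMem hvC]
          have := hCn.ncard_pos
          omega
        refine ih _ (hn ▸ hlt) _ rfl h2 (connected_induce_insert hWc hv hCW ?_) ?_
        · intro a ha b hb hab
          rw [hWCD] at hb
          rcases hb with hb | hb | hb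
          · exact Or.inr hb
          · exact Or.inl hb
          · exact absurd hab (hsep a ha b hb)
        · intro H hH
          rcases hWb H hH with h | h
          · rcases hcl H hH h with h | h
            · exact Or.inl h
            · refine Or.inr (Set.subsingleton_singleton.anti (t := {v}) ?_)
              rw [← hCDv, Set.inter_comm]
              exact Set.inter_subset_inter_right _ h
          · exact Or.inr (h.anti (Set.inter_subset_inter_right _ hvCW))
      obtain ⟨sA, fA⟩ := sub A B hAn hBn hWAB hvA hvB hAB hInt hsep hcl
      obtain ⟨sB, fB⟩ := sub B A hBn hAn (Set.union_comm A B ▸ hWAB) hvB hvA hAB.symm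
        (Set.inter_comm _ _ ▸ hInt) (fun b hb a ha hba => hsep a ha b hb hba.symm)
        (fun H hH hHW => (hcl H hH hHW).symm)
      have hWU : W = insert v A ∪ insert v B := by
        rw [hWAB, Set.insert_union_distrib]
      have hblocks : blocksIn G W = blocksIn G (insert v A) ∪ blocksIn G (insert v B) := by
        ext H
        simp only [blocksIn, mem_union, mem_filter, mem_blocks]
        constructor
        · rintro ⟨hH, hHW⟩
          exact (hcl H hH hHW).imp (⟨hH, ·⟩) (⟨hH, ·⟩)
        · rintro (⟨hH, h⟩ | ⟨hH, h⟩)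
          · exact ⟨hH, hWU ▸ h.trans Set.subset_union_left⟩
          · exact ⟨hH, hWU ▸ h.trans Set.subset_union_right⟩
      have hdisj : Disjoint (blocksIn G (insert v A)) (blocksIn G (insert v B)) := by
        rw [Finset.disjoint_left]
        intro H h1 h2
        simp only [blocksIn, mem_filter, mem_blocks] at h1 h2
        have h := Set.ncard_le_ncard (hInt ▸ Set.subset_inter h1.2 h2.2) (Set.toFinite {v})
        rw [Set.ncard_singleton] at h
        have := hsize H h1.1
        omega
      have hcard : W.ncard + 1 = (insert v A).ncard + (insert v B).ncard := by
        have := Set.ncard_union_add_ncard_inter (insert v A) (insert v B)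
        rwa [hInt, Set.ncard_singleton, ← hWU] at this
      refine ⟨?_, fun r hr => ?_⟩
      · rw [hblocks, sum_union hdisj]
        omega
      · obtain ⟨S₁, hS₁, hc₁⟩ := fA r hr
        obtain ⟨S₂, hS₂, hc₂⟩ := fB v (Set.mem_insert _ _)
        refine ⟨_, hS₁.glue hWU hInt hr ?_ hS₂, ?_⟩
        · rintro a (ha | ha) hav b (hb | hb) hbv
          · exact absurd ha hav
          · exact absurd ha hav
          · exact absurd hb hbv
          · exact hsep a ha b hb
        · have hd : Disjoint S₁ (S₂ \ {v}) := by
            rw [Set.disjoint_left]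
            rintro x hx ⟨hx2, hxv⟩
            apply hxv
            rw [← hInt]
            exact ⟨hS₁.2.1 hx, hS₂.2.1 hx2⟩
          have h1 := Set.ncard_sdiff_singleton_add_one hS₂.1
          rw [Set.ncard_union_eq hd, hblocks, card_union_of_disjoint hdisj]
          omega
    obtain ⟨A, hAW, hAn, hBn, hsep⟩ := exists_separation hdis
    have hvA : v ∉ A := fun h => (hAW h).2 rfl
    have hvB : v ∉ (W \ {v}) \ A := fun h => h.1.2 rfl
    have hWAB : W = insert v (A ∪ (W \ {v}) \ A) := by
      rw [Set.union_sdiff_cancel hAW, Set.insert_sdiff_singleton, Set.insert_eq_of_mem hv]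
    have m₁ := main _ _ hAn hBn hWAB hvA hvB Set.disjoint_sdiff_right hsep
    have m₂ := main _ _ hBn hAn (by rwa [Set.union_comm]) hvB hvA Set.disjoint_sdiff_left
      fun b hb a ha hba => hsep a ha b hb hba.symm
    refine ⟨m₁.1, fun r hr => ?_⟩
    rw [hWAB] at hr
    rcases hr with hr | hr | hr
    · exact m₁.2 r (Or.inl hr)
    · exact m₁.2 r (Or.inr hr)
    · exact m₂.2 r (Or.inr hr)

theorem IsCliqueTree.two_lt_card (hG : IsCliqueTree G)
    (hsize : ∀ H : G.Subgraph, IsBlock G H → 3 ≤ H.verts.ncard) : 2 < Fintype.card V := by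
  obtain ⟨x⟩ := hG.1.nonempty
  obtain ⟨H, hH, -⟩ := exists_isBlock_mem (G := G) x
  have h := Set.ncard_le_card H.verts
  rw [Nat.card_eq_fintype_card] at h
  exact (hsize H hH).trans h

theorem blocksIn_univ : blocksIn G Set.univ = blocks G := by
  simp [blocksIn]

theorem IsCliqueTree.blocks_sum_and_forcesWithout_univ (hG : IsCliqueTree G)
    (hsize : ∀ H : G.Subgraph, IsBlock G H → 3 ≤ H.verts.ncard) :
    ∑ H ∈ blocks G, (H.verts.ncard - 1) + 1 = Fintype.card V ∧
      ∃ S r, ForcesWithout G Set.univ r S ∧ S.ncard + (blocks G).card = Fintype.card V := by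
  have hu : (Set.univ : Set V).ncard = Fintype.card V := by
    rw [Set.ncard_univ, Nat.card_eq_fintype_card]
  have h2 := hG.two_lt_card hsize
  have h := hG.blocksIn_sum_and_forcesWithout hsize _ Set.univ rfl (by omega)
    (G.induceUnivIso.connected_iff.2 hG.1) fun H _ => Or.inl (Set.subset_univ _)
  rw [blocksIn_univ, hu] at h
  obtain ⟨r⟩ := hG.1.nonempty
  obtain ⟨S, hS⟩ := h.2 r trivial
  exact ⟨h.1, S, r, hS⟩

theorem IsCliqueTree.zeroForcingNumber_add_card_blocks (hG : IsCliqueTree G)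
    (hsize : ∀ H : G.Subgraph, IsBlock G H → 3 ≤ H.verts.ncard) :
    zeroForcingNumber G + (blocks G).card = Fintype.card V := by
  classical
  apply le_antisymm
  · obtain ⟨-, S, r, hS, hc⟩ := hG.blocks_sum_and_forcesWithout_univ hsize
    have h := zeroForcingNumber_le (S := S.toFinset) (by simpa using hS.isZeroForcingSet)
    rw [← Set.ncard_eq_toFinset_card'] at h
    omega
  · obtain ⟨S, hS, hf⟩ := exists_card_eq_zeroForcingNumber G
    exact hS ▸ hG.card_le_card_add_card_blocks hf

theorem IsCliqueTree.zeroForcingNumber_block (hG : IsCliqueTree G) {H : G.Subgraph}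
    (hH : IsBlock G H) (h2 : 2 ≤ H.verts.ncard) :
    zeroForcingNumber H.coe = H.verts.ncard - 1 := by
  have := Fintype.ofFinite H.verts
  have hc : Fintype.card H.verts = H.verts.ncard := by
    rw [← Nat.card_eq_fintype_card, Nat.card_coe_set_eq]
  rw [hG.2 H hH, zeroForcingNumber_top (by omega), hc]

theorem sum_blockIndex (G : SimpleGraph V) :
    ∑ v : V, blockIndex G v = ∑ H ∈ blocks G, H.verts.ncard := by
  classical
  have h := sum_card_bipartiteAbove_eq_sum_card_bipartiteBelow
    (s := (Finset.univ : Finset V)) (t := blocks G) fun v H => v ∈ H.verts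
  convert h using 2 with v _ H _
  · rw [blockIndex, ← Set.ncard_coe_finset]
    congr 1
    ext H
    simp [bipartiteAbove]
  · rw [← Set.ncard_coe_finset]
    congr 1
    ext v
    simp [bipartiteBelow]

end Main

end CliqueTree

/-! ### The formula, the bounds and the extremal cases -/

theorem mainTheorem2 {V : Type*} [Fintype V] (G : SimpleGraph V)
    (hG : CliqueTree.IsCliqueTree G)
    (hsize : ∀ H : G.Subgraph, CliqueTree.IsBlock G H → 3 ≤ H.verts.ncard) :
    -- the formula for the zero forcing number
    ((CliqueTree.zeroForcingNumber G : ℤ) =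
      (∑ H ∈ CliqueTree.blocks G, (CliqueTree.zeroForcingNumber H.coe : ℤ))
        - ∑ v : V, ((CliqueTree.blockIndex G v : ℤ) - 1)) ∧
    -- `k = n - b`
    ((CliqueTree.zeroForcingNumber G : ℤ) =
      (Fintype.card V : ℤ) - ((CliqueTree.blocks G).card : ℤ)) ∧
    -- `⌊n / 2⌋ + 1 ≤ k ≤ n - 1`
    Fintype.card V / 2 + 1 ≤ CliqueTree.zeroForcingNumber G ∧
    (CliqueTree.zeroForcingNumber G : ℤ) ≤ (Fintype.card V : ℤ) - 1 ∧
    -- the block sizes when `k = ⌊n / 2⌋ + 1`, for even and for odd `n`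
    (Even (Fintype.card V) →
      CliqueTree.zeroForcingNumber G = Fintype.card V / 2 + 1 →
      (∀ H : G.Subgraph, CliqueTree.IsBlock G H → H.verts.ncard = 3 ∨ H.verts.ncard = 4) ∧
      ({H : G.Subgraph | CliqueTree.IsBlock G H ∧ H.verts.ncard = 3}.ncard : ℤ) =
        ((Fintype.card V / 2 : ℕ) : ℤ) - 2 ∧
      {H : G.Subgraph | CliqueTree.IsBlock G H ∧ H.verts.ncard = 4}.ncard = 1) ∧
    (Odd (Fintype.card V) →
      CliqueTree.zeroForcingNumber G = Fintype.card V / 2 + 1 →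
      (∀ H : G.Subgraph, CliqueTree.IsBlock G H → H.verts.ncard = 3) ∧
      (CliqueTree.blocks G).card = Fintype.card V / 2) := by
  classical
  have hn := hG.two_lt_card hsize
  have hZ := hG.zeroForcingNumber_add_card_blocks hsize
  have hsum := (hG.blocks_sum_and_forcesWithout_univ hsize).1
  -- Splitting `|H| - 1 = (|H| - 3) + 2` isolates the excess over triangles.
  have hsum3 : ∑ H ∈ CliqueTree.blocks G, (H.verts.ncard - 3) + 2 * (CliqueTree.blocks G).card + 1 =
      Fintype.card V := by
    rw [← hsum, mul_comm, ← smul_eq_mul, ← Finset.sum_const, ← Finset.sum_add_distrib]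
    congr 1
    refine Finset.sum_congr rfl fun H hH => ?_
    have := hsize H (CliqueTree.mem_blocks.1 hH)
    omega
  have hpos : 0 < (CliqueTree.blocks G).card := by
    obtain ⟨x⟩ := hG.1.nonempty
    obtain ⟨H, hH, -⟩ := CliqueTree.exists_isBlock_mem (G := G) x
    exact Finset.card_pos.2 ⟨H, CliqueTree.mem_blocks.2 hH⟩
  have hset : ∀ m : ℕ, {H : G.Subgraph | CliqueTree.IsBlock G H ∧ H.verts.ncard = m}.ncard =
      ((CliqueTree.blocks G).filter fun H => H.verts.ncard = m).card := by
    intro m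
    rw [← Set.ncard_coe_finset]
    congr 1
    ext H
    simp
  refine ⟨?_, by omega, by omega, by omega, fun heven hk => ?_, fun hodd hk => ?_⟩
  · have h1 : ∑ H ∈ CliqueTree.blocks G, (CliqueTree.zeroForcingNumber H.coe : ℤ) =
        ∑ H ∈ CliqueTree.blocks G, (H.verts.ncard : ℤ) - (CliqueTree.blocks G).card := by
      rw [Finset.card_eq_sum_ones, Nat.cast_sum, ← Finset.sum_sub_distrib]
      refine Finset.sum_congr rfl fun H hH => ?_
      have hH' := CliqueTree.mem_blocks.1 hH
      have h3 := hsize H hH'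
      rw [hG.zeroForcingNumber_block hH' (by omega)]
      push_cast [Nat.cast_sub (by omega : 1 ≤ H.verts.ncard)]
      rfl
    have h2 : ∑ v : V, (CliqueTree.blockIndex G v : ℤ) =
        ∑ H ∈ CliqueTree.blocks G, (H.verts.ncard : ℤ) := by
      exact_mod_cast CliqueTree.sum_blockIndex G
    rw [h1, Finset.sum_sub_distrib, h2, Finset.sum_const, Finset.card_univ]
    simp only [nsmul_eq_mul, mul_one]
    omega
  · rw [hset, hset]
    obtain ⟨m, hm⟩ := heven
    -- For `n = 2m` and `k = m + 1` there are `b = m - 1` blocks, so the excess is `2m - 1 - 2(m -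
    -- 1) = 1`, carried by a single block.
    have hone : ∑ H ∈ CliqueTree.blocks G, (H.verts.ncard - 3) = 1 := by omega
    have hex : ∃ K ∈ CliqueTree.blocks G, K.verts.ncard - 3 ≠ 0 :=
      Finset.exists_ne_zero_of_sum_ne_zero (by omega)
    obtain ⟨K, hK, hK0⟩ := hex
    rw [← Finset.add_sum_erase _ _ hK] at hone
    have hrest : ∑ H ∈ (CliqueTree.blocks G).erase K, (H.verts.ncard - 3) = 0 := by omega
    rw [Finset.sum_eq_zero_iff] at hrest
    have hK4 : K.verts.ncard = 4 := by omega
    have h3 : ∀ H ∈ CliqueTree.blocks G, H ≠ K → H.verts.ncard = 3 := by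
      intro H hH hHK
      have h0 := hrest H (Finset.mem_erase.2 ⟨hHK, hH⟩)
      have h1 := hsize H (CliqueTree.mem_blocks.1 hH)
      omega
    have hf3 : ((CliqueTree.blocks G).filter fun H => H.verts.ncard = 3) =
        (CliqueTree.blocks G).erase K := by
      ext H
      simp only [Finset.mem_filter, Finset.mem_erase]
      refine ⟨fun ⟨h, h'⟩ => ⟨?_, h⟩, fun ⟨h, h'⟩ => ⟨h', h3 H h' h⟩⟩
      rintro rfl
      omega
    have hf4 : ((CliqueTree.blocks G).filter fun H => H.verts.ncard = 4) = {K} := by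
      ext H
      simp only [Finset.mem_filter, Finset.mem_singleton]
      refine ⟨fun ⟨h, h'⟩ => ?_, fun h => h ▸ ⟨hK, hK4⟩⟩
      by_contra hne
      have := h3 H h hne
      omega
    refine ⟨fun H hH => ?_, ?_, ?_⟩
    · by_cases hHK : H = K
      · exact Or.inr (hHK ▸ hK4)
      · exact Or.inl (h3 H (CliqueTree.mem_blocks.2 hH) hHK)
    · rw [hf3, Finset.card_erase_of_mem hK]
      omega
    · rw [hf4, Finset.card_singleton]
  · obtain ⟨m, hm⟩ := hodd
    -- Here `n = 2m + 1` and `b = m`, so the excess vanishes.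
    have hzero : ∑ H ∈ CliqueTree.blocks G, (H.verts.ncard - 3) = 0 := by omega
    rw [Finset.sum_eq_zero_iff] at hzero
    refine ⟨fun H hH => ?_, by omega⟩
    have h0 := hzero H (CliqueTree.mem_blocks.2 hH)
    have h1 := hsize H hH
    omega
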